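/- For $n\ge 0$ let $S_n(123)$ be the set of permutations $\sigma=\sigma_1\cdots\sigma_n$ of $\{1,\dots,n\}$ without indices $i<j<l$ such that $\sigma_i<\sigma_j<\sigma_l$. We say that $\sigma_i$ matches $\mathrm{MMP}(0,k,0,0)$ in $\sigma$ if there are at least $k$ indices $j<i$ with $\sigma_j>\sigma_i$; let $\mathrm{mmp}^{(0,k,0,0)}(\sigma)$ be the number of such $i$. We call $\sigma_i$ a peak of $\sigma$ if it is a left-to-right minimum ($\sigma_j>\sigma_i$ for all $j<i$), and a non-peak otherwise. Put $$Q_{123}^{(0,k,0,0)}(t,x)=1+\sum_{n\ge1}t^n\sum_{\sigma\in S_n(123)}x^{\mathrm{mmp}^{(0,k,0,0)}(\sigma)},$$ and for $k_1,k_2\ge0$ $$Q_n^{k_1,k_2}(x_0,x_1)=\sum_{\sigma\in S_n(123)}x_0^{p_{k_1}(\sigma)}\,x_1^{r_{k_2}(\sigma)},\qquad Q^{k_1,k_2}(t,x_0,x_1)=\sum_{n\ge0}t^n\,Q_n^{k_1,k_2}(x_0,x_1),$$ where $p_{k}(\sigma)$ (respectively $r_{k}(\sigma)$) is the number of peaks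 (respectively non-peaks) of $\sigma$ that match $\mathrm{MMP}(0,k,0,0)$; thus $Q^{k_1,k_2}(t,x_0,x_1)=Q_{123}^{(0,\binom{k_1}{k_2},0,0)}(t,x_0,x_1)$. Write $Q^{a,b}$ for $Q^{a,b}(t,x_0,x_1)$. Empty sums are $0$. The following are identities of formal power series in $t$ with coefficients in $\mathbb{Z}[x_0,x_1]$ (equivalently, for all elements $x_0,x_1$ of any commutative ring). For all $k_1>0$, the series $1-tx_1Q^{0,0}$ is invertible and $$Q^{k_1,0}=\frac{1}{1-t x_1Q^{0,0}}\Bigl(1+tQ^{k_1-1,0}+t x_1\sum_{i=2}^{k_1-1}t^{i-1}Q_{i-1}^{0,0}(1,x_1)\,Q^{k_1-i,0}-t x_1Q^{0,0}\sum_{i=0}^{\max(k_1-2,0)}t^iQ_{i}^{0,0}(1,x_1)\Bigr).$$ For all $k_2>0$, $$Q^{0,k_2}=1+t x_0Q^{0,k_2-1}+t\sum_{i=2}^{k_2-1}Q_{i-1}^{0,0}(x_0,1)\,t^{i-1}Q^{0,k_2-i}+tQ^{0,0}\Bigl(Q^{0,k_2-1}-\sum_{i=0}^{\max(k_2-2,0)}Q_i^{0,0}(x_0,1)\,t^i\Bigr).$$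 For $k_1\ge k_2\ge1$, $$Q^{k_1,k_2}=1+t\sum_{i=1}^{k_1-1}Q_{i-1}^{0,k_2-1}(1,x_1)\,t^{i-1}Q^{k_1-i,\max(k_2-i,0)}+tQ^{0,0}\Bigl(Q^{k_1,k_2-1}-\sum_{i=0}^{k_1-2}Q_i^{0,k_2-1}(1,x_1)\,t^i\Bigr).$$ For $k_2>k_1\ge1$, $$Q^{k_1,k_2}=1+t\sum_{i=1}^{k_2-1}Q_{i-1}^{k_1,0}(x_0,1)\,t^{i-1}Q^{\max(k_1-i,0),k_2-i}+tQ^{0,0}\Bigl(Q^{k_1,k_2-1}-\sum_{i=0}^{k_2-2}Q_i^{k_1,0}(x_0,1)\,t^i\Bigr).$$ Finally, for all $k\ge0$, $$Q_{123}^{(0,k,0,0)}(t,x)=Q^{k,k}(t,x,x).$$ -/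

import Mathlib

open Finset

namespace MMP123

/-- The pattern `τ` occurs in `σ`: some subsequence of `σ`, at positions
`f 0 < f 1 < ... < f (j-1)`, is order isomorphic to `τ`. -/
def Occurs {j n : ℕ} (τ : Equiv.Perm (Fin j)) (σ : Equiv.Perm (Fin n)) : Prop :=
  ∃ f : Fin j → Fin n, (∀ a b, a < b → f a < f b) ∧
    ∀ a b, σ (f a) < σ (f b) ↔ τ a < τ b

instance {j n : ℕ} (τ : Equiv.Perm (Fin j)) (σ : Equiv.Perm (Fin n)) :
    Decidable (Occurs τ σ) := by
  unfold Occurs; infer_instance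

/-- The set `S_n(τ)` of permutations of size `n` that avoid `τ`. -/
def avoiders {j : ℕ} (τ : Equiv.Perm (Fin j)) (n : ℕ) : Finset (Equiv.Perm (Fin n)) :=
  univ.filter fun σ => ¬ Occurs τ σ

/-- The pattern `123`, i.e. the identity permutation of size `3`. -/
def pat123 : Equiv.Perm (Fin 3) := 1

/-- Number of points of the graph of `σ` in quadrant I relative to `(i, σ i)`. -/
def quadI {n : ℕ} (σ : Equiv.Perm (Fin n)) (i : Fin n) : ℕ :=
  (univ.filter fun j => i < j ∧ σ i < σ j).card

/-- Number of points of the graph of `σ` in quadrant II relative to `(i, σ i)`. -/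
def quadII {n : ℕ} (σ : Equiv.Perm (Fin n)) (i : Fin n) : ℕ :=
  (univ.filter fun j => j < i ∧ σ i < σ j).card

/-- Number of points of the graph of `σ` in quadrant III relative to `(i, σ i)`. -/
def quadIII {n : ℕ} (σ : Equiv.Perm (Fin n)) (i : Fin n) : ℕ :=
  (univ.filter fun j => j < i ∧ σ j < σ i).card

/-- Number of points of the graph of `σ` in quadrant IV relative to `(i, σ i)`. -/
def quadIV {n : ℕ} (σ : Equiv.Perm (Fin n)) (i : Fin n) : ℕ :=
  (univ.filter fun j => i < j ∧ σ j < σ i).card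

/-- `σ i` matches the quadrant marked mesh pattern `MMP(a,b,c,d)` in `σ`. -/
def Matches (a b c d : ℕ) {n : ℕ} (σ : Equiv.Perm (Fin n)) (i : Fin n) : Prop :=
  a ≤ quadI σ i ∧ b ≤ quadII σ i ∧ c ≤ quadIII σ i ∧ d ≤ quadIV σ i

instance (a b c d : ℕ) {n : ℕ} (σ : Equiv.Perm (Fin n)) (i : Fin n) :
    Decidable (Matches a b c d σ i) := by
  unfold Matches; infer_instance

/-- The number of `i` such that `σ i` matches `MMP(a,b,c,d)` in `σ`. -/
def mmp (a b c d : ℕ) {n : ℕ} (σ : Equiv.Perm (Fin n)) : ℕ :=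
  (univ.filter fun i => Matches a b c d σ i).card

/-- `σ i` is a peak of `σ`, i.e. a left-to-right minimum. -/
def IsPeak {n : ℕ} (σ : Equiv.Perm (Fin n)) (i : Fin n) : Prop :=
  ∀ j, j < i → σ i < σ j

instance {n : ℕ} (σ : Equiv.Perm (Fin n)) (i : Fin n) : Decidable (IsPeak σ i) := by
  unfold IsPeak; infer_instance

/-- The number of peaks of `σ` that match `MMP(0,k,0,0)`. -/
def peakMmp (k : ℕ) {n : ℕ} (σ : Equiv.Perm (Fin n)) : ℕ :=
  (univ.filter fun i => IsPeak σ i ∧ Matches 0 k 0 0 σ i).card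

/-- The number of non-peaks of `σ` that match `MMP(0,k,0,0)`. -/
def nonPeakMmp (k : ℕ) {n : ℕ} (σ : Equiv.Perm (Fin n)) : ℕ :=
  (univ.filter fun i => ¬ IsPeak σ i ∧ Matches 0 k 0 0 σ i).card

section

variable {R : Type*} [CommRing R]

/-- `Q_{n,τ}^{(a,b,c,d)}(x)`, at an element `x` of a commutative ring (the polynomial itself is
the case of an indeterminate `x`). -/
def Qn {j : ℕ} (τ : Equiv.Perm (Fin j)) (a b c d n : ℕ) (x : R) : R :=
  ∑ σ ∈ avoiders τ n, x ^ mmp a b c d σ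

/-- `Q_τ^{(a,b,c,d)}(t,x) = 1 + ∑_{n ≥ 1} Q_{n,τ}^{(a,b,c,d)}(x) t^n`, a formal power series
in `t`. -/
def Qgf {j : ℕ} (τ : Equiv.Perm (Fin j)) (a b c d : ℕ) (x : R) : PowerSeries R :=
  PowerSeries.mk fun n => if n = 0 then 1 else Qn τ a b c d n x

/-- The refined polynomial `Q_{n,123}^{(0, binom(k₁,k₂), 0, 0)}(x₀,x₁)`. -/
def Rn (k₁ k₂ n : ℕ) (x₀ x₁ : R) : R :=
  ∑ σ ∈ avoiders pat123 n, x₀ ^ peakMmp k₁ σ * x₁ ^ nonPeakMmp k₂ σ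

/-- The refined generating function `Q_{123}^{(0, binom(k₁,k₂), 0, 0)}(t,x₀,x₁)`, a formal power
series in `t`. -/
def Rgf (k₁ k₂ : ℕ) (x₀ x₁ : R) : PowerSeries R :=
  PowerSeries.mk fun n => Rn k₁ k₂ n x₀ x₁

end

end MMP123

/-!
A `123`-avoiding permutation is encoded by the Dyck path that runs below its graph through its
left-to-right minima. A peak at position `i` has exactly its `i` predecessors in quadrant II
(positions counted from `0`), and a non-peak of value `v` has exactly the larger values there, since
a larger value to its right would complete a `123`. So the two statistics can be read off the path:
peaks correspond to turns and are compared with `k₁` by their column, non-peaks correspond to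
consecutive down steps and are compared with `k₂` by their row, counted from the top
(`Rn_eq_tailSum`).

Cutting the path at its first return to the diagonal after `i + 1` columns gives a component of size
`i + 1` followed by an arbitrary path whose two thresholds have dropped by `i + 1`. The component is
a lifted path of size `i`. If `i > 0`, lifting adds one non-peak in the top row and pushes the
others down by one row; if `i = 0`, the component is one peak. This is the recursion `Rn_succ`. Once
`i` is large both remaining thresholds are `0`, so the tail of the convolution is a multiple of
`Rgf 0 0 x₀ x₁` (`Rgf_eq`). For small `i` the component is too short for one of the two statistics
to count anything, so one of the variables may be set to `1` (`Rn_eq_of_le_left`,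
`Rn_eq_of_le_right`). The four recursions are the cases of `Rgf_eq` according to which of `k₁`, `k₂`
vanish and which is the larger.

The path decomposition is carried out without constructing paths or a bijection on permutations.
The weighted sums `tailSum` over the possible continuations of a prefix satisfy a local recursion
(`tailSum_succ`), obtained by removing the first letter, and this recursion alone implies the
first-passage decomposition (`first_passage`).
-/

namespace MMP123

/-! ### Prepending a letter to a permutation -/

/-- The permutation whose word starts with `v` and continues with a word order isomorphic to the
word of `τ`. -/
def consPerm {m : ℕ} (v : Fin (m + 1)) (τ : Equiv.Perm (Fin m)) : Equiv.Perm (Fin (m + 1)) :=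
  (finSuccEquiv' 0).trans ((Equiv.optionCongr τ).trans (finSuccEquiv' v).symm)

@[simp]
theorem consPerm_zero {m : ℕ} (v : Fin (m + 1)) (τ : Equiv.Perm (Fin m)) :
    consPerm v τ 0 = v := by
  simp [consPerm]

@[simp]
theorem consPerm_succ {m : ℕ} (v : Fin (m + 1)) (τ : Equiv.Perm (Fin m)) (i : Fin m) :
    consPerm v τ i.succ = v.succAbove (τ i) := by
  have h : finSuccEquiv' (0 : Fin (m + 1)) i.succ = some i := by
    rw [← Fin.zero_succAbove, finSuccEquiv'_succAbove]
  simp [consPerm, h]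

theorem consPerm_bijective (m : ℕ) :
    Function.Bijective fun p : Fin (m + 1) × Equiv.Perm (Fin m) => consPerm p.1 p.2 := by
  rw [Fintype.bijective_iff_injective_and_card]
  refine ⟨?_, by simp [Fintype.card_perm, Nat.factorial_succ]⟩
  rintro ⟨v, τ⟩ ⟨v', τ'⟩ h
  have h0 : v = v' := by simpa using DFunLike.congr_fun h 0
  subst h0
  refine Prod.ext rfl (Equiv.ext fun i => ?_)
  simpa using DFunLike.congr_fun h i.succ

theorem sum_perm_eq_sum_consPerm {m : ℕ} {M : Type*} [AddCommMonoid M]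
    (f : Equiv.Perm (Fin (m + 1)) → M) :
    ∑ τ, f τ = ∑ v, ∑ τ, f (consPerm v τ) := by
  rw [← Fintype.sum_prod_type']
  exact ((Equiv.ofBijective _ (consPerm_bijective m)).sum_comp f).symm

/-! ### Tails of `123`-avoiding permutations -/

/-- `τ` avoids `123`, and its values `≥ a` occur in decreasing order. Up to standardization, these
are the words that can follow a prefix of a `123`-avoiding permutation whose minimum exceeds exactly
`a` of the remaining values. -/
def IsTail {m : ℕ} (a : ℕ) (τ : Equiv.Perm (Fin m)) : Prop :=
  (∀ i j l, i < j → j < l → τ i < τ j → ¬ τ j < τ l) ∧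
    ∀ i j, i < j → a ≤ (τ i : ℕ) → ¬ τ i < τ j

theorem isPeak_consPerm_zero {m : ℕ} (v : Fin (m + 1)) (τ : Equiv.Perm (Fin m)) :
    IsPeak (consPerm v τ) 0 := fun j hj => absurd hj (Fin.not_lt_zero j)

theorem isPeak_consPerm_succ {m : ℕ} (v : Fin (m + 1)) (τ : Equiv.Perm (Fin m)) (i : Fin m) :
    IsPeak (consPerm v τ) i.succ ↔ (τ i : ℕ) < v ∧ IsPeak τ i := by
  have key : v.succAbove (τ i) < v ↔ (τ i : ℕ) < v := by
    rw [Fin.succAbove_lt_iff_castSucc_lt, Fin.lt_def, Fin.val_castSucc]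
  simp [IsPeak, Fin.forall_fin_succ, key]

theorem isTail_consPerm {m : ℕ} (a : ℕ) (v : Fin (m + 1)) (τ : Equiv.Perm (Fin m)) :
    IsTail a (consPerm v τ) ↔
      (∀ i j l, i < j → j < l → τ i < τ j → ¬ τ j < τ l) ∧
      (∀ i j, i < j → (v : ℕ) ≤ τ i → ¬ τ i < τ j) ∧
      (a ≤ v → v = Fin.last m) ∧
      ∀ i j, i < j → a ≤ (v.succAbove (τ i) : ℕ) → ¬ τ i < τ j := by
  have key (i : Fin m) : v < v.succAbove (τ i) ↔ (v : ℕ) ≤ τ i := by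
    rw [Fin.lt_succAbove_iff_le_castSucc, Fin.le_def, Fin.val_castSucc]
  -- The first letter `v` is followed by no larger value exactly when it is the maximum.
  have hlast : (∀ i, ¬ (v : ℕ) ≤ τ i) ↔ v = Fin.last m := by
    constructor
    · intro h
      by_contra hv
      have hlt : (v : ℕ) < m := Fin.val_lt_last hv
      exact h (τ.symm ⟨v, hlt⟩) (by simp)
    · rintro rfl i
      simp
  simp only [IsTail, Fin.forall_fin_succ, consPerm_zero, consPerm_succ, Fin.succ_lt_succ_iff,
    Fin.succAbove_lt_succAbove_iff, key, Fin.succ_pos, forall_const,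
    IsEmpty.forall_iff, true_and, implies_true, not_lt_zero]
  rw [← hlast]
  grind

section

variable {R : Type*} [CommRing R]

/-- The weight of a tail. A left-to-right minimum below the threshold `a` contributes `x₀` when its
position is at least `k₁`; any other point whose value lies at least `k₂ + 1` below the threshold
contributes `x₁`. The points of value `≥ a` contribute nothing: in the ambient permutation they
are non-peaks whose weight belongs to the step at which the running minimum passed below them. -/
def tailWeight {m : ℕ} (a k₁ k₂ : ℕ) (x₀ x₁ : R) (τ : Equiv.Perm (Fin m)) : R :=
  ∏ i, if IsPeak τ i ∧ (τ i : ℕ) < a then (if k₁ ≤ (i : ℕ) then x₀ else 1)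
    else if k₂ + τ i < a then x₁ else 1

open Classical in
/-- `tailWeight`, extended by zero to permutations that are not tails. -/
noncomputable def tailTerm {m : ℕ} (a k₁ k₂ : ℕ) (x₀ x₁ : R) (τ : Equiv.Perm (Fin m)) : R :=
  if IsTail a τ then tailWeight a k₁ k₂ x₀ x₁ τ else 0

/-- The total weight of the tails of size `m` with threshold `a`. In terms of lattice paths, this
is the weighted count of the completions of a partial path of down and right steps that is `m - a`
steps away from the diagonal, has `a` down steps still to come, and does not end in a down step. -/
noncomputable def tailSum (m a k₁ k₂ : ℕ) (x₀ x₁ : R) : R :=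
  ∑ τ : Equiv.Perm (Fin m), tailTerm a k₁ k₂ x₀ x₁ τ

/-- A tail cannot start with a value at or above the threshold unless that value is the maximum. -/
theorem tailTerm_consPerm_eq_zero {m a : ℕ} (k₁ k₂ : ℕ) (x₀ x₁ : R) {v : Fin (m + 1)}
    (hav : a ≤ v) (hv : v ≠ Fin.last m) (τ : Equiv.Perm (Fin m)) :
    tailTerm a k₁ k₂ x₀ x₁ (consPerm v τ) = 0 :=
  if_neg fun h => hv (((isTail_consPerm a v τ).1 h).2.2.1 hav)

theorem tailTerm_consPerm_last {m a : ℕ} (k₁ k₂ : ℕ) (x₀ x₁ : R) (ham : a ≤ m)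
    (τ : Equiv.Perm (Fin m)) :
    tailTerm a k₁ k₂ x₀ x₁ (consPerm (Fin.last m) τ) = tailTerm a (k₁ - 1) k₂ x₀ x₁ τ := by
  have hT : IsTail a (consPerm (Fin.last m) τ) ↔ IsTail a τ := by
    rw [isTail_consPerm]
    have h (i : Fin m) : ¬ m ≤ (τ i : ℕ) := by simp
    simp [IsTail, h]
  have hW : tailWeight a k₁ k₂ x₀ x₁ (consPerm (Fin.last m) τ) =
      tailWeight a (k₁ - 1) k₂ x₀ x₁ τ := by
    unfold tailWeight
    rw [Fin.prod_univ_succ]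
    have h0 : ¬ m < a := by omega
    have h1 : ¬ k₂ + m < a := by omega
    simp [isPeak_consPerm_succ, h0, h1]
  by_cases h : IsTail a τ
  · rw [tailTerm, tailTerm, if_pos (hT.2 h), if_pos h, hW]
  · rw [tailTerm, tailTerm, if_neg (mt hT.1 h), if_neg h]

/-- Removing a first letter that lies just below the threshold: it is a peak at position `0`. -/
theorem tailTerm_consPerm_succ_self {m : ℕ} (k₁ k₂ : ℕ) (x₀ x₁ : R) (v : Fin (m + 1))
    (τ : Equiv.Perm (Fin m)) :
    tailTerm (v + 1) k₁ k₂ x₀ x₁ (consPerm v τ) =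
      (if k₁ = 0 then x₀ else 1) * tailTerm v (k₁ - 1) (k₂ - 1) x₀ x₁ τ := by
  have hval (i : Fin m) :
      (v.succAbove (τ i) : ℕ) = if (τ i : ℕ) < v then (τ i : ℕ) else τ i + 1 := by
    simp only [Fin.succAbove, Fin.lt_def, Fin.val_castSucc]
    split_ifs <;> simp
  have hT : IsTail (v + 1) (consPerm v τ) ↔ IsTail v τ := by
    rw [isTail_consPerm, IsTail]
    simp only [hval]
    grind
  have hW : tailWeight (v + 1) k₁ k₂ x₀ x₁ (consPerm v τ) =
      (if k₁ = 0 then x₀ else 1) * tailWeight v (k₁ - 1) (k₂ - 1) x₀ x₁ τ := by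
    unfold tailWeight
    rw [Fin.prod_univ_succ]
    congr 1
    · simp [isPeak_consPerm_zero]
    · refine Finset.prod_congr rfl fun i _ => ?_
      simp only [isPeak_consPerm_succ, consPerm_succ, hval, Fin.val_succ]
      grind
  by_cases h : IsTail v τ
  · rw [tailTerm, tailTerm, if_pos (hT.2 h), if_pos h, hW]
  · rw [tailTerm, tailTerm, if_neg (mt hT.1 h), if_neg h, mul_zero]

/-- When the first letter is smaller than `a`, the value `a` is not a peak, so lowering the threshold
from `a + 1` to `a` changes the weight only by the contribution of this one value. -/
theorem tailTerm_succ_consPerm_of_lt {m a : ℕ} (k₁ k₂ : ℕ) (x₀ x₁ : R) {v : Fin (m + 1)}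
    (hv : (v : ℕ) < a) (ham : a ≤ m) (τ : Equiv.Perm (Fin m)) :
    tailTerm (a + 1) k₁ k₂ x₀ x₁ (consPerm v τ) =
      (if k₂ = 0 then x₁ else 1) * tailTerm a k₁ (k₂ - 1) x₀ x₁ (consPerm v τ) := by
  have hle (i : Fin m) : (v.succAbove (τ i) : ℕ) ≤ τ i + 1 := by
    simp only [Fin.succAbove]
    split_ifs <;> simp
  have hT : IsTail (a + 1) (consPerm v τ) ↔ IsTail a (consPerm v τ) := by
    rw [isTail_consPerm, isTail_consPerm]
    grind
  -- A peak is at most the first letter, so the value `a` is never a peak.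
  have hP (i : Fin (m + 1)) (hi : IsPeak (consPerm v τ) i) : (consPerm v τ i : ℕ) < a := by
    refine i.cases (fun _ => by simpa using hv) (fun i hi => ?_) hi
    have := (isPeak_consPerm_succ v τ i).1 hi
    have := hle i
    simp only [consPerm_succ]
    omega
  have hW : tailWeight (a + 1) k₁ k₂ x₀ x₁ (consPerm v τ) =
      (if k₂ = 0 then x₁ else 1) * tailWeight a k₁ (k₂ - 1) x₀ x₁ (consPerm v τ) := by
    have hc : (if k₂ = 0 then x₁ else 1) = ∏ i : Fin (m + 1),
        if i = (consPerm v τ).symm ⟨a, by omega⟩ then (if k₂ = 0 then x₁ else 1) else 1 := by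
      simp
    rw [hc]
    unfold tailWeight
    rw [← Finset.prod_mul_distrib]
    refine Finset.prod_congr rfl fun i _ => ?_
    have := hP i
    simp only [Equiv.eq_symm_apply, Fin.ext_iff]
    grind
  by_cases h : IsTail a (consPerm v τ)
  · rw [tailTerm, tailTerm, if_pos (hT.2 h), if_pos h, hW]
  · rw [tailTerm, tailTerm, if_neg (mt hT.1 h), if_neg h, mul_zero]

theorem tailSum_zero_zero (k₁ k₂ : ℕ) (x₀ x₁ : R) : tailSum 0 0 k₁ k₂ x₀ x₁ = 1 := by
  simp [tailSum, tailTerm, tailWeight, IsTail]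

/-- The recursion for tails, from the three possibilities for the first letter: the maximum (if it
is above the threshold), the value `a` just below the threshold, or a value smaller than `a`. In the
last case the tails are those of threshold `a` that do not start with the maximum, which accounts
for the difference in the last summand. -/
theorem tailSum_succ {m a : ℕ} (ham : a ≤ m) (k₁ k₂ : ℕ) (x₀ x₁ : R) :
    tailSum (m + 1) (a + 1) k₁ k₂ x₀ x₁ =
      (if a < m then tailSum m (a + 1) (k₁ - 1) k₂ x₀ x₁ else 0) +
      (if k₁ = 0 then x₀ else 1) * tailSum m a (k₁ - 1) (k₂ - 1) x₀ x₁ +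
      (if k₂ = 0 then x₁ else 1) *
        (tailSum (m + 1) a k₁ (k₂ - 1) x₀ x₁ - tailSum m a (k₁ - 1) (k₂ - 1) x₀ x₁) := by
  have hlast (a' k₂' : ℕ) (h : a' ≤ m) :
      ∑ τ, tailTerm a' k₁ k₂' x₀ x₁ (consPerm (Fin.last m) τ) =
        tailSum m a' (k₁ - 1) k₂' x₀ x₁ :=
    Finset.sum_congr rfl fun τ _ => tailTerm_consPerm_last k₁ k₂' x₀ x₁ h τ
  have hself := fun v : Fin (m + 1) => (Finset.sum_congr rfl fun τ _ =>
    tailTerm_consPerm_succ_self k₁ k₂ x₀ x₁ v τ : ∑ τ, _ = ∑ τ, _)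
  -- The contribution of the words that start with `v`, compared with that for threshold `a`.
  have hpoint (v : Fin (m + 1)) : ∑ τ, tailTerm (a + 1) k₁ k₂ x₀ x₁ (consPerm v τ) =
      (if k₂ = 0 then x₁ else 1) * ∑ τ, tailTerm a k₁ (k₂ - 1) x₀ x₁ (consPerm v τ) +
      ((if v = Fin.last m then
          (if a < m then tailSum m (a + 1) (k₁ - 1) k₂ x₀ x₁ else 0) -
          (if k₂ = 0 then x₁ else 1) * tailSum m a (k₁ - 1) (k₂ - 1) x₀ x₁ else 0) +
        (if v = ⟨a, by omega⟩ then
          (if k₁ = 0 then x₀ else 1) * tailSum m a (k₁ - 1) (k₂ - 1) x₀ x₁ else 0)) := by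
    rcases lt_trichotomy (v : ℕ) a with hv | hv | hv
    · rw [Finset.sum_congr rfl fun τ _ => tailTerm_succ_consPerm_of_lt k₁ k₂ x₀ x₁ hv ham τ,
        if_neg fun h : v = Fin.last m => (hv.trans_le ham).ne (Fin.ext_iff.1 h),
        if_neg fun h : v = ⟨a, _⟩ => hv.ne (Fin.ext_iff.1 h), Finset.mul_sum, add_zero, add_zero]
    · subst hv
      rw [hself, ← Finset.mul_sum, if_pos rfl]
      by_cases hl : v = Fin.last m
      · subst hl
        rw [hlast _ _ ham]
        simp [tailSum]
      · rw [if_neg hl, Finset.sum_eq_zero fun τ _ =>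
          tailTerm_consPerm_eq_zero k₁ (k₂ - 1) x₀ x₁ le_rfl hl τ]
        simp [tailSum]
    · have hva : v ≠ ⟨a, by omega⟩ := fun h => hv.ne' (Fin.ext_iff.1 h)
      rw [if_neg hva]
      by_cases hl : v = Fin.last m
      · subst hl
        rw [hlast _ _ ham, hlast _ _ hv]
        simp only [Fin.val_last] at hv
        simp [hv]
      · rw [if_neg hl, Finset.sum_eq_zero fun τ _ =>
          tailTerm_consPerm_eq_zero k₁ k₂ x₀ x₁ hv hl τ, Finset.sum_eq_zero fun τ _ =>
          tailTerm_consPerm_eq_zero k₁ (k₂ - 1) x₀ x₁ hv.le hl τ]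
        simp
  have hS (a' k₂' : ℕ) : tailSum (m + 1) a' k₁ k₂' x₀ x₁ =
      ∑ v, ∑ τ, tailTerm a' k₁ k₂' x₀ x₁ (consPerm v τ) := sum_perm_eq_sum_consPerm _
  rw [hS, Finset.sum_congr rfl fun v _ => hpoint v, Finset.sum_add_distrib,
    Finset.sum_add_distrib, ← Finset.mul_sum, ← hS]
  simp only [Finset.sum_ite_eq', Finset.mem_univ, if_true]
  ring

theorem tailSum_zero_right (m k₁ k₂ : ℕ) (x₀ x₁ : R) : tailSum m 0 k₁ k₂ x₀ x₁ = 1 := by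
  induction m generalizing k₁ with
  | zero => exact tailSum_zero_zero k₁ k₂ x₀ x₁
  | succ m ih =>
    rw [tailSum, sum_perm_eq_sum_consPerm, Finset.sum_eq_single (Fin.last m)]
    · rw [Finset.sum_congr rfl fun τ _ =>
        tailTerm_consPerm_last k₁ k₂ x₀ x₁ (Nat.zero_le m) τ]
      exact ih (k₁ - 1)
    · exact fun v _ hv => Finset.sum_eq_zero fun τ _ =>
        tailTerm_consPerm_eq_zero k₁ k₂ x₀ x₁ (Nat.zero_le _) hv τ
    · simp

/-! ### First-passage decomposition -/

theorem sum_antidiagonal_assoc {M : Type*} [AddCommMonoid M] (f : ℕ → ℕ → ℕ → M) (n : ℕ) :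
    ∑ p ∈ antidiagonal n, ∑ q ∈ antidiagonal p.1, f q.1 q.2 p.2 =
      ∑ p ∈ antidiagonal n, ∑ q ∈ antidiagonal p.2, f p.1 q.1 q.2 := by
  rw [Finset.sum_sigma', Finset.sum_sigma']
  refine Finset.sum_nbij' (fun x => ⟨(x.2.1, x.2.2 + x.1.2), (x.2.2, x.1.2)⟩)
    (fun x => ⟨(x.1.1 + x.2.1, x.2.2), (x.1.1, x.2.1)⟩) ?_ ?_ ?_ ?_ fun _ _ => rfl <;>
  · rintro ⟨⟨a, b⟩, ⟨c, d⟩⟩ h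
    simp only [mem_sigma, HasAntidiagonal.mem_antidiagonal] at h ⊢
    obtain ⟨h₁, h₂⟩ := h
    subst h₂
    simp [add_assoc, ← h₁]

/-- First-passage decomposition. Let `w a b k l` be a weighted count of path completions from
distance `b` to the diagonal with `a` down steps to come, satisfying the recursion of
`tailSum_succ`. A path from distance `b + 1` first makes an excursion that comes no closer, with `i`
down and `i` right steps, then a right step to distance `b`, and continues from there. The threshold
`k` drops by the number of right steps made, and `l` by the number of down steps. -/
theorem first_passage (w : ℕ → ℕ → ℕ → ℕ → R) (y₀ y₁ : ℕ → R)
    (h_zero : ∀ b k l, w 0 b k l = 1)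
    (h_ground : ∀ a k l, w (a + 1) 0 k l =
      y₀ k * w a 0 (k - 1) (l - 1) + y₁ l * (w a 1 k (l - 1) - w a 0 (k - 1) (l - 1)))
    (h_succ : ∀ a b k l, w (a + 1) (b + 1) k l =
      w (a + 1) b (k - 1) l + y₀ k * w a (b + 1) (k - 1) (l - 1) +
        y₁ l * (w a (b + 2) k (l - 1) - w a (b + 1) (k - 1) (l - 1)))
    (a b k l : ℕ) :
    w a (b + 1) k l =
      ∑ p ∈ antidiagonal a, w p.1 0 k l * w p.2 b (k - (p.1 + 1)) (l - p.1) := by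
  induction a using Nat.strong_induction_on generalizing b k l with
  | _ a ih =>
  rcases a with _ | a
  · simp [h_zero]
  -- The excursion starts with a down step followed by a right step.
  have hdiag : ∑ p ∈ antidiagonal a,
      w p.1 0 (k - 1) (l - 1) * w p.2 b (k - (p.1 + 1 + 1)) (l - (p.1 + 1)) =
        w a (b + 1) (k - 1) (l - 1) := by
    rw [ih a (Nat.lt_succ_self a)]
    refine Finset.sum_congr rfl fun p _ => ?_
    rw [Nat.sub_sub, Nat.sub_sub, add_comm 1 (p.1 + 1), add_comm 1 p.1]
  -- The excursion starts with two down steps. Both sides count paths from distance `b + 2`, which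
  -- reach distances `b + 1` and `b` in turn, and differ in the order of the two splittings.
  have hup : ∑ p ∈ antidiagonal a,
      w p.1 1 k (l - 1) * w p.2 b (k - (p.1 + 1 + 1)) (l - (p.1 + 1)) =
        w a (b + 2) k (l - 1) := by
    rw [ih a (Nat.lt_succ_self a)]
    have hin : ∀ p ∈ antidiagonal a,
        w p.1 0 k (l - 1) * w p.2 (b + 1) (k - (p.1 + 1)) (l - 1 - p.1) =
          ∑ q ∈ antidiagonal p.2, w p.1 0 k (l - 1) *
            w q.1 0 (k - (p.1 + 1)) (l - 1 - p.1) *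
              w q.2 b (k - (p.1 + q.1 + 2)) (l - (p.1 + q.1 + 1)) := by
      intro p hp
      have hpa : p.2 < a + 1 := by have := mem_antidiagonal.1 hp; omega
      rw [ih p.2 hpa, Finset.mul_sum]
      refine Finset.sum_congr rfl fun q _ => ?_
      rw [mul_assoc, Nat.sub_sub k, Nat.sub_sub (l - 1)]
      rw [show p.1 + 1 + (q.1 + 1) = p.1 + q.1 + 2 by ring,
        show l - 1 - (p.1 + q.1) = l - (p.1 + q.1 + 1) by omega]
    have hout : ∀ p ∈ antidiagonal a,
        w p.1 1 k (l - 1) * w p.2 b (k - (p.1 + 1 + 1)) (l - (p.1 + 1)) =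
          ∑ q ∈ antidiagonal p.1, w q.1 0 k (l - 1) *
            w q.2 0 (k - (q.1 + 1)) (l - 1 - q.1) *
              w p.2 b (k - (q.1 + q.2 + 2)) (l - (q.1 + q.2 + 1)) := by
      intro p hp
      have hpa : p.1 < a + 1 := by have := mem_antidiagonal.1 hp; omega
      rw [ih p.1 hpa 0, Finset.sum_mul]
      refine Finset.sum_congr rfl fun q hq => ?_
      rw [mem_antidiagonal.1 hq]
    rw [Finset.sum_congr rfl hin, Finset.sum_congr rfl hout]
    exact sum_antidiagonal_assoc (fun i j r => w i 0 k (l - 1) *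
      w j 0 (k - (i + 1)) (l - 1 - i) * w r b (k - (i + j + 2)) (l - (i + j + 1))) a
  rw [h_succ, Finset.Nat.sum_antidiagonal_succ, ← hdiag, ← hup, add_assoc, ← Finset.sum_sub_distrib,
    Finset.mul_sum, Finset.mul_sum, ← Finset.sum_add_distrib]
  congr 1
  · simp [h_zero]
  · refine Finset.sum_congr rfl fun p _ => ?_
    rw [h_ground]
    ring

/-! ### Recursion for the refined polynomials -/

/-- A full permutation is a tail whose threshold exceeds all values. The two descriptions of the
weight agree because all predecessors of a peak are larger than it, while all values larger than a
non-peak precede it when `123` is avoided. -/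
theorem Rn_eq_tailSum (k₁ k₂ n : ℕ) (x₀ x₁ : R) :
    Rn k₁ k₂ n x₀ x₁ = tailSum n n k₁ k₂ x₀ x₁ := by
  have hOcc (σ : Equiv.Perm (Fin n)) : ¬ Occurs pat123 σ ↔ IsTail n σ := by
    have hn (i : Fin n) : ¬ n ≤ (σ i : ℕ) := by simp
    simp only [IsTail, hn, false_imp_iff, implies_true, and_true]
    constructor
    · intro h i j l hij hjl h₁ h₂
      refine h ⟨![i, j, l], ?_, ?_⟩
      · intro a b hab
        fin_cases a <;> fin_cases b <;> simp_all [hij.trans hjl]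
      · intro a b
        fin_cases a <;> fin_cases b <;>
          simp [pat123, h₁, h₂, h₁.trans h₂, h₁.le, h₂.le, (h₁.trans h₂).le]
    · rintro h ⟨f, hf, hσ⟩
      exact h (f 0) (f 1) (f 2) (hf 0 1 (by decide)) (hf 1 2 (by decide))
        ((hσ 0 1).2 (by decide)) ((hσ 1 2).2 (by decide))
  have hpeak (σ : Equiv.Perm (Fin n)) (i : Fin n) (hi : IsPeak σ i) : quadII σ i = i := by
    rw [quadII, ← Fin.card_Iio i]
    congr 1
    ext j
    simpa using hi j
  have hnon (σ : Equiv.Perm (Fin n)) (hσ : IsTail n σ) (i : Fin n) (hi : ¬ IsPeak σ i) :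
      quadII σ i = n - 1 - σ i := by
    -- A larger value to the right of `i` would complete the ascent `σ j < σ i` to a `123`.
    obtain ⟨j, hji, hj⟩ : ∃ j, j < i ∧ σ j ≤ σ i := by simpa [IsPeak] using hi
    have hlt : σ j < σ i := lt_of_le_of_ne hj fun h => hji.ne (σ.injective h)
    rw [quadII, ← Fin.card_Ioi (σ i), ← Finset.card_map σ.toEmbedding]
    congr 1
    ext v
    simp only [mem_map, mem_filter, mem_univ, true_and, Equiv.coe_toEmbedding, mem_Ioi]
    constructor
    · rintro ⟨l, ⟨-, h⟩, rfl⟩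
      exact h
    · intro h
      refine ⟨σ.symm v, ⟨?_, by simpa using h⟩, by simp⟩
      by_contra hl
      rcases (not_lt.1 hl).lt_or_eq with hl | hl
      · exact hσ.1 j i _ hji hl hlt (by simpa using h)
      · exact h.ne (by rw [hl, Equiv.apply_symm_apply])
  have hW (σ : Equiv.Perm (Fin n)) (hσ : IsTail n σ) :
      x₀ ^ peakMmp k₁ σ * x₁ ^ nonPeakMmp k₂ σ = tailWeight n k₁ k₂ x₀ x₁ σ := by
    rw [peakMmp, nonPeakMmp, ← Finset.prod_const, ← Finset.prod_const, Finset.prod_filter,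
      Finset.prod_filter, ← Finset.prod_mul_distrib]
    refine Finset.prod_congr rfl fun i _ => ?_
    have := (σ i).isLt
    by_cases hi : IsPeak σ i
    · simp [hi, Matches, hpeak]
    · have : k₂ ≤ n - 1 - σ i ↔ k₂ + σ i < n := by omega
      simp [hi, Matches, hnon σ hσ i hi, this]
  rw [Rn, avoiders, Finset.sum_filter, tailSum]
  refine Finset.sum_congr rfl fun σ _ => ?_
  by_cases h : IsTail n σ
  · rw [if_pos ((hOcc σ).2 h), tailTerm, if_pos h, hW σ h]
  · rw [if_neg (mt (hOcc σ).1 h), tailTerm, if_neg h]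

theorem Rn_zero (k₁ k₂ : ℕ) (x₀ x₁ : R) : Rn k₁ k₂ 0 x₀ x₁ = 1 := by
  rw [Rn_eq_tailSum, tailSum_zero_zero]

/-- The first-return recursion for the refined polynomials. The summand with `p.1 = 0` is taken out
and replaced by the first term, because a first component of size one is a peak. -/
theorem Rn_succ (k₁ k₂ n : ℕ) (x₀ x₁ : R) :
    Rn k₁ k₂ (n + 1) x₀ x₁ =
      (if k₁ = 0 then x₀ else 1) * Rn (k₁ - 1) (k₂ - 1) n x₀ x₁ +
      (if k₂ = 0 then x₁ else 1) *
        (∑ p ∈ antidiagonal n,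
          Rn k₁ (k₂ - 1) p.1 x₀ x₁ * Rn (k₁ - 1 - p.1) (k₂ - 1 - p.1) p.2 x₀ x₁ -
            Rn (k₁ - 1) (k₂ - 1) n x₀ x₁) := by
  have key := first_passage (fun a b k l => tailSum (a + b) a k l x₀ x₁)
    (fun k => if k = 0 then x₀ else 1) (fun l => if l = 0 then x₁ else 1)
    (fun b k l => tailSum_zero_right _ k l x₀ x₁)
    (fun a k l => by simpa using tailSum_succ (le_refl a) k l x₀ x₁)
    (fun a b k l => by
      have h := tailSum_succ (by omega : a ≤ a + (b + 1)) k l x₀ x₁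
      rw [if_pos (by omega)] at h
      have e₁ : a + 1 + (b + 1) = a + (b + 1) + 1 := by omega
      have e₂ : a + 1 + b = a + (b + 1) := by omega
      have e₃ : a + (b + 2) = a + (b + 1) + 1 := by omega
      simp only [e₁, e₂, e₃]
      exact h)
    n 0 k₁ (k₂ - 1)
  simp only [Rn_eq_tailSum]
  rw [tailSum_succ le_rfl, if_neg (lt_irrefl n), zero_add]
  simp only [zero_add, add_zero] at key
  rw [key]
  simp only [Nat.sub_sub, add_comm 1]

theorem quadII_le {n : ℕ} (σ : Equiv.Perm (Fin n)) (i : Fin n) : quadII σ i ≤ i := by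
  rw [quadII, ← Fin.card_Iio i]
  exact Finset.card_le_card fun j hj => by simpa using (Finset.mem_filter.1 hj).2.1

/-- In a permutation of size at most `k₁` no point has `k₁` predecessors, so no peak is counted. -/
theorem Rn_eq_of_le_left {k₁ n : ℕ} (h : n ≤ k₁) (k₂ : ℕ) (x₀ x₁ : R) :
    Rn k₁ k₂ n x₀ x₁ = Rn 0 k₂ n 1 x₁ := by
  refine Finset.sum_congr rfl fun σ _ => ?_
  have : peakMmp k₁ σ = 0 := by
    rw [peakMmp, Finset.card_eq_zero, Finset.filter_eq_empty_iff]
    rintro i - ⟨-, -, hi, -⟩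
    have := quadII_le σ i
    omega
  rw [this, pow_zero, one_pow]

/-- In a permutation of size at most `k₂` no non-peak is counted. -/
theorem Rn_eq_of_le_right {k₂ n : ℕ} (h : n ≤ k₂) (k₁ : ℕ) (x₀ x₁ : R) :
    Rn k₁ k₂ n x₀ x₁ = Rn k₁ 0 n x₀ 1 := by
  refine Finset.sum_congr rfl fun σ _ => ?_
  have : nonPeakMmp k₂ σ = 0 := by
    rw [nonPeakMmp, Finset.card_eq_zero, Finset.filter_eq_empty_iff]
    rintro i - ⟨-, -, hi, -⟩
    have := quadII_le σ i
    omega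
  rw [this, pow_zero, one_pow]

/-! ### Generating functions -/

open PowerSeries in
/-- A convolution `∑ i, r i * t ^ i * G i` in which the factor `G i` is eventually constant, split at
the index `K` from which it is. -/
theorem mk_sum_antidiagonal_eq (r : ℕ → R) (G : ℕ → PowerSeries R) {H : PowerSeries R} {K : ℕ}
    (hG : ∀ i, K ≤ i → G i = H) :
    PowerSeries.mk (fun n => ∑ p ∈ antidiagonal n, r p.1 * coeff p.2 (G p.1)) =
      ∑ i ∈ range K, C (r i) * X ^ i * G i +
        H * (PowerSeries.mk r - ∑ i ∈ range K, C (r i) * X ^ i) := by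
  have hsplit : ∀ i n, coeff n (C (r i) * X ^ i * (G i - H)) =
      if i ≤ n then r i * coeff (n - i) (G i - H) else 0 := by
    intro i n
    rw [mul_assoc, coeff_C_mul, coeff_X_pow_mul', mul_ite, mul_zero]
  have hmain : PowerSeries.mk (fun n => ∑ p ∈ antidiagonal n, r p.1 * coeff p.2 (G p.1 - H)) =
      ∑ i ∈ range K, C (r i) * X ^ i * (G i - H) := by
    ext n
    rw [coeff_mk, map_sum, Finset.Nat.sum_antidiagonal_eq_sum_range_succ
      (fun i j => r i * coeff j (G i - H)), Finset.sum_congr rfl fun i _ => hsplit i n]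
    calc _ = ∑ i ∈ range (n + 1), if i ≤ n then r i * coeff (n - i) (G i - H) else 0 :=
          Finset.sum_congr rfl fun i hi => by
            rw [if_pos (Nat.lt_succ_iff.1 (Finset.mem_range.1 hi))]
      _ = ∑ i ∈ range (n + 1 + K), if i ≤ n then r i * coeff (n - i) (G i - H) else 0 :=
          Finset.sum_subset (by simp) fun i _ hi => by
            rw [if_neg fun h => hi (Finset.mem_range.2 (Nat.lt_succ_of_le h))]
      _ = _ := (Finset.sum_subset (by simp) fun i _ hi => by
            simp [hG i (by simpa using hi)]).symm
  have hlin : PowerSeries.mk (fun n => ∑ p ∈ antidiagonal n, r p.1 * coeff p.2 (G p.1)) =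
      PowerSeries.mk (fun n => ∑ p ∈ antidiagonal n, r p.1 * coeff p.2 (G p.1 - H)) +
        PowerSeries.mk r * H := by
    ext n
    simp [coeff_mul, mul_sub]
  rw [hlin, hmain]
  simp only [mul_sub, Finset.sum_sub_distrib, ← Finset.sum_mul]
  ring

open PowerSeries in
/-- The functional equation behind all four recursions. From `i = K` on, both thresholds of the
second factor have dropped to `0`, so that these summands collect into a multiple of
`Rgf 0 0 x₀ x₁`. The parameter `r` allows a simplified form of the first `K` coefficients. -/
theorem Rgf_eq {k₁ k₂ K : ℕ} (h₁ : k₁ ≤ K + 1) (h₂ : k₂ ≤ K + 1) (x₀ x₁ : R) (r : ℕ → R)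
    (hr : ∀ i < K, Rn k₁ (k₂ - 1) i x₀ x₁ = r i) :
    Rgf k₁ k₂ x₀ x₁ = 1 + X * (C (if k₁ = 0 then x₀ else 1) * Rgf (k₁ - 1) (k₂ - 1) x₀ x₁ +
      C (if k₂ = 0 then x₁ else 1) *
        (∑ i ∈ range K, C (r i) * X ^ i *
            Rgf (k₁ - 1 - i) (k₂ - 1 - i) x₀ x₁ +
          Rgf 0 0 x₀ x₁ * (Rgf k₁ (k₂ - 1) x₀ x₁ -
            ∑ i ∈ range K, C (r i) * X ^ i) -
          Rgf (k₁ - 1) (k₂ - 1) x₀ x₁)) := by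
  have hr' (F : ℕ → PowerSeries R) : ∑ i ∈ range K, C (r i) * F i =
      ∑ i ∈ range K, C (Rn k₁ (k₂ - 1) i x₀ x₁) * F i :=
    Finset.sum_congr rfl fun i hi => by rw [hr i (Finset.mem_range.1 hi)]
  simp only [mul_assoc, hr']
  simp only [← mul_assoc]
  have hconv := mk_sum_antidiagonal_eq (fun i => Rn k₁ (k₂ - 1) i x₀ x₁)
    (fun i => Rgf (k₁ - 1 - i) (k₂ - 1 - i) x₀ x₁) (H := Rgf 0 0 x₀ x₁) (K := K)
    (fun i hi => by rw [show k₁ - 1 - i = 0 by omega, show k₂ - 1 - i = 0 by omega])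
  rw [show Rgf k₁ (k₂ - 1) x₀ x₁ = PowerSeries.mk fun i => Rn k₁ (k₂ - 1) i x₀ x₁ from rfl, ← hconv]
  ext n
  rcases n with _ | n
  · simp [Rgf, Rn_zero]
  · rw [map_add, coeff_succ_X_mul, map_add, coeff_C_mul, coeff_C_mul, map_sub, coeff_mk]
    simp [Rgf, Rn_succ k₁ k₂ n, coeff_one]

theorem mmp_eq_add (k : ℕ) {n : ℕ} (σ : Equiv.Perm (Fin n)) :
    mmp 0 k 0 0 σ = peakMmp k σ + nonPeakMmp k σ := by
  rw [mmp, peakMmp, nonPeakMmp, ← Finset.card_filter_add_card_filter_not (fun i => IsPeak σ i)]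
  simp only [Finset.filter_filter, and_comm]

theorem Qgf_eq_Rgf (k : ℕ) (x : R) : Qgf pat123 0 k 0 0 x = Rgf k k x x := by
  have h (n : ℕ) : Qn pat123 0 k 0 0 n x = Rn k k n x x :=
    Finset.sum_congr rfl fun σ _ => by rw [mmp_eq_add, pow_add]
  ext n
  rcases n with _ | n
  · simp [Qgf, Rgf, Rn_zero]
  · simp [Qgf, Rgf, h]

theorem sum_Icc_one_eq {M : Type*} [AddCommMonoid M] (f : ℕ → M) (n : ℕ) :
    ∑ i ∈ Icc 1 n, f i = ∑ i ∈ range n, f (i + 1) := by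
  rw [Finset.range_eq_Ico, Finset.sum_Ico_add' f 0 n 1]
  rfl

theorem sum_Icc_two_eq {M : Type*} [AddCommMonoid M] (f : ℕ → M) (n : ℕ) :
    ∑ i ∈ Icc 2 (n + 1), f i = ∑ i ∈ range n, f (i + 2) := by
  rw [Finset.range_eq_Ico, Finset.sum_Ico_add' f 0 n 2]
  rfl

end

end MMP123

open PowerSeries MMP123 in
theorem mainTheorem11 {R : Type*} [CommRing R] (x₀ x₁ : R) :
    (∀ k₁ : ℕ, 0 < k₁ →
      IsUnit (1 - X * C x₁ * Rgf 0 0 x₀ x₁) ∧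
      Rgf k₁ 0 x₀ x₁ =
        Ring.inverse (1 - X * C x₁ * Rgf 0 0 x₀ x₁) *
          (1 + X * Rgf (k₁ - 1) 0 x₀ x₁
            + X * C x₁ * ∑ i ∈ Finset.Icc 2 (k₁ - 1),
                X ^ (i - 1) * C (Rn 0 0 (i - 1) 1 x₁) * Rgf (k₁ - i) 0 x₀ x₁
            - X * C x₁ * Rgf 0 0 x₀ x₁ *
                ∑ i ∈ Finset.Icc 0 (max (k₁ - 2) 0), X ^ i * C (Rn 0 0 i 1 x₁))) ∧
    (∀ k₂ : ℕ, 0 < k₂ →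
      Rgf 0 k₂ x₀ x₁ =
        1 + X * C x₀ * Rgf 0 (k₂ - 1) x₀ x₁
          + X * ∑ i ∈ Finset.Icc 2 (k₂ - 1),
              C (Rn 0 0 (i - 1) x₀ 1) * X ^ (i - 1) * Rgf 0 (k₂ - i) x₀ x₁
          + X * Rgf 0 0 x₀ x₁ *
              (Rgf 0 (k₂ - 1) x₀ x₁
                - ∑ i ∈ Finset.Icc 0 (max (k₂ - 2) 0), C (Rn 0 0 i x₀ 1) * X ^ i)) ∧
    (∀ k₁ k₂ : ℕ, k₂ ≤ k₁ → 1 ≤ k₂ →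
      Rgf k₁ k₂ x₀ x₁ =
        1 + X * ∑ i ∈ Finset.Icc 1 (k₁ - 1),
              C (Rn 0 (k₂ - 1) (i - 1) 1 x₁) * X ^ (i - 1) *
                Rgf (k₁ - i) (max (k₂ - i) 0) x₀ x₁
          + X * Rgf 0 0 x₀ x₁ *
              (Rgf k₁ (k₂ - 1) x₀ x₁
                - ∑ i ∈ Finset.range (k₁ - 1), C (Rn 0 (k₂ - 1) i 1 x₁) * X ^ i)) ∧
    (∀ k₁ k₂ : ℕ, k₁ < k₂ → 1 ≤ k₁ →
      Rgf k₁ k₂ x₀ x₁ =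
        1 + X * ∑ i ∈ Finset.Icc 1 (k₂ - 1),
              C (Rn k₁ 0 (i - 1) x₀ 1) * X ^ (i - 1) *
                Rgf (max (k₁ - i) 0) (k₂ - i) x₀ x₁
          + X * Rgf 0 0 x₀ x₁ *
              (Rgf k₁ (k₂ - 1) x₀ x₁
                - ∑ i ∈ Finset.range (k₂ - 1), C (Rn k₁ 0 i x₀ 1) * X ^ i)) ∧
    (∀ (k : ℕ) (x : R), Qgf pat123 0 k 0 0 x = Rgf k k x x) := by
  have e₃ (i : ℕ) : i + 2 - 1 = i + 1 := by omega
  have e₄ (k i : ℕ) : k + 1 + 1 - (i + 2) = k + 1 - (i + 1) := by omega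
  refine ⟨fun k₁ hk => ?_, fun k₂ hk => ?_, fun k₁ k₂ hle hk => ?_, fun k₁ k₂ hlt hk => ?_,
    Qgf_eq_Rgf⟩
  · have hu : IsUnit (1 - X * C x₁ * Rgf 0 0 x₀ x₁) := by
      rw [PowerSeries.isUnit_iff_constantCoeff]
      simp
    refine ⟨hu, ?_⟩
    rw [← Ring.inverse_mul_cancel_left _ (Rgf k₁ 0 x₀ x₁) hu]
    congr 1
    have hR := Rgf_eq (K := k₁ - 1) (k₁ := k₁) (k₂ := 0) (by omega) (by omega) x₀ x₁
      (fun i => Rn 0 0 i 1 x₁) (fun i hi => Rn_eq_of_le_left (by omega) 0 x₀ x₁)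
    rw [if_neg hk.ne', if_pos rfl] at hR
    simp only [Nat.zero_sub, map_one, one_mul] at hR
    rcases k₁ with _ | _ | k
    · omega
    · -- Here `k₁ - 2` is truncated to `0`: the subtracted sum has one term, which accounts for the
      -- component of size one.
      simp only [zero_add, Nat.sub_self, range_zero, sum_empty] at hR
      simp [Rn_zero]
      linear_combination hR
    · have e₁ : k + 1 + 1 - 1 = k + 1 := by omega
      have e₂ : max (k + 1 + 1 - 2) 0 = k := by omega
      rw [e₁, sum_range_succ' (fun i => C (Rn 0 0 i 1 x₁) * X ^ i * Rgf (k + 1 - i) 0 x₀ x₁)] at hR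
      rw [e₁, e₂, sum_Icc_two_eq, ← Nat.range_succ_eq_Icc_zero]
      simp only [e₃, e₄, mul_comm (X ^ _) (C _)]
      simp only [Rn_zero, map_one, pow_zero, Nat.sub_zero, one_mul] at hR
      linear_combination hR
  · have hR := Rgf_eq (K := k₂ - 1) (k₁ := 0) (k₂ := k₂) (by omega) (by omega) x₀ x₁
      (fun i => Rn 0 0 i x₀ 1) (fun i hi => Rn_eq_of_le_right (by omega) 0 x₀ x₁)
    rw [if_neg hk.ne', if_pos rfl] at hR
    simp only [Nat.zero_sub, map_one, one_mul] at hR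
    rcases k₂ with _ | _ | k
    · omega
    · simp only [zero_add, Nat.sub_self, range_zero, sum_empty] at hR
      simp [Rn_zero]
      linear_combination hR
    · have e₁ : k + 1 + 1 - 1 = k + 1 := by omega
      have e₂ : max (k + 1 + 1 - 2) 0 = k := by omega
      rw [e₁, sum_range_succ' (fun i => C (Rn 0 0 i x₀ 1) * X ^ i * Rgf 0 (k + 1 - i) x₀ x₁)] at hR
      rw [e₁, e₂, sum_Icc_two_eq, ← Nat.range_succ_eq_Icc_zero]
      simp only [e₃, e₄]
      simp only [Rn_zero, map_one, pow_zero, Nat.sub_zero, one_mul] at hR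
      linear_combination hR
  · have hR := Rgf_eq (K := k₁ - 1) (k₁ := k₁) (k₂ := k₂) (by omega) (by omega) x₀ x₁
      (fun i => Rn 0 (k₂ - 1) i 1 x₁) (fun i hi => Rn_eq_of_le_left (by omega) _ x₀ x₁)
    rw [if_neg (by omega), if_neg (by omega)] at hR
    rw [sum_Icc_one_eq]
    simp only [Nat.sub_sub, Nat.add_sub_cancel, Nat.max_zero, add_comm 1, map_one, one_mul] at hR ⊢
    linear_combination hR
  · have hR := Rgf_eq (K := k₂ - 1) (k₁ := k₁) (k₂ := k₂) (by omega) (by omega) x₀ x₁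
      (fun i => Rn k₁ 0 i x₀ 1) (fun i hi => Rn_eq_of_le_right (by omega) k₁ x₀ x₁)
    rw [if_neg (by omega), if_neg (by omega)] at hR
    rw [sum_Icc_one_eq]
    simp only [Nat.sub_sub, Nat.add_sub_cancel, Nat.max_zero, add_comm 1, map_one, one_mul] at hR ⊢
    linear_combination hR
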